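/- Let $G$ be a finite group and $\operatorname{Irr} G$ its set of irreducible complex characters. A partition $\mathcal C$ of a set is \emph{finer} than a partition $\mathcal D$ (and $\mathcal D$ \emph{coarser} than $\mathcal C$) if every block of $\mathcal C$ is contained in a block of $\mathcal D$. For $X\subseteq \operatorname{Irr} G$ put $\sigma_X=\sum_{\chi\in X}\chi(1)\chi$, and for $K\subseteq G$ put $\hat K=\sum_{g\in K} g\in\mathbb{C}G$. Characters are extended linearly to $\mathbb{C}G$. For a collection $\mathcal X$ of subsets of $\operatorname{Irr} G$, let $\operatorname{ClPt}(\mathcal X)$ be the partition of $G$ into the classes of the equivalence relation: $g\sim h$ if and only if $\sigma_X(g)=\sigma_X(h)$ for all $X\in\mathcal X$. For a collection $\mathcal K$ of $G$-invariant subsets of $G$ (that is, subsets closed under conjugation), let $\operatorname{IrPt}(\mathcal K)$ be the partition of $\operatorname{Irr} G$ into the classes of the equivalence relation: $\chi\sim\psi$ if and only if $\chi(\hat K)/\chi(1)=\psi(\hat K)/\psi(1)$ for all $K\in\mathcal K$. (a) Let $\mathcal K$ be a collection of $G$-invariant subsets of $G$. Then $\operatorname{ClPt}(\operatorname{IrPt}(\mathcal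 K))$ is the coarsest partition $\mathcal L$ of $G$ such that the linear span of the sums $\hat L$, $L\in\mathcal L$, contains the unital subalgebra of $Z(\mathbb{C}G)$ generated by the sums $\hat K$, $K\in\mathcal K$. That is, this partition has the stated property, and every partition of $G$ with the property is finer than it. (b) Let $\mathcal X$ be a collection of subsets of $\operatorname{Irr} G$. Then $\operatorname{IrPt}(\operatorname{ClPt}(\mathcal X))$ is the coarsest partition $\mathcal Y$ of $\operatorname{Irr} G$ such that the linear span of the characters $\sigma_Y$, $Y\in\mathcal Y$, contains the unital subalgebra of the algebra $\operatorname{cf}(G)$ of complex class functions on $G$ (with pointwise multiplication) generated by the characters $\sigma_X$, $X\in\mathcal X$. That is, this partition has the stated property, and every partition of $\operatorname{Irr} G$ with the property is finer than it. -/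

import Mathlib

noncomputable section

namespace Supercharacter

universe u

/-- `IsIrrChar χ` says that `χ` is the character of an irreducible finite-dimensional complex
representation of `G`. -/
def IsIrrChar {G : Type u} [Group G] (χ : G → ℂ) : Prop :=
  ∃ (V : Type u) (_ : AddCommGroup V) (_ : Module ℂ V) (_ : FiniteDimensional ℂ V)
    (ρ : Representation ℂ G V), ρ.IsIrreducible ∧ ρ.character = χ

/-- The set of irreducible complex characters of `G`. -/
abbrev Irr (G : Type u) [Group G] : Type u := {χ : G → ℂ // IsIrrChar χ}

instance (G : Type u) [Group G] : CoeFun (Irr G) (fun _ => G → ℂ) := ⟨Subtype.val⟩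

/-- A finite group has only finitely many irreducible characters (so that the sums over sets of
irreducible characters below are honest finite sums). -/
instance finite_irr (G : Type u) [Group G] [Finite G] : Finite (Irr G) := by
  classical
  have : Fintype G := Fintype.ofFinite G
  have : Invertible (Nat.card G : ℂ) :=
    invertibleOfNonzero (by exact_mod_cast Nat.card_pos.ne')
  have key : ∀ χ ψ : Irr G,
      (Nat.card G : ℂ)⁻¹ * ∑ g : G, χ g * ψ g⁻¹ = if χ = ψ then 1 else 0 := by
    intro χ ψ
    obtain ⟨V, i1, i2, i3, ρ, hρ, hρχ⟩ := χ.2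
    obtain ⟨W, j1, j2, j3, σ, hσ, hσψ⟩ := ψ.2
    have h := Representation.char_orthonormal ρ σ
    have h' := Representation.char_orthonormal ρ ρ
    have hρρ : Nonempty (Representation.Equiv ρ ρ) := ⟨Representation.Equiv.refl ρ⟩
    rw [if_pos hρρ, hρχ] at h'
    rw [hρχ, hσψ] at h
    by_cases hc : χ = ψ
    · subst hc
      simpa using h'
    · have hne : ¬ Nonempty (Representation.Equiv σ ρ) := by
        rintro ⟨φ⟩
        exact hc (Subtype.ext (hρχ.symm.trans ((Representation.char_iso φ).symm.trans hσψ)))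
      rw [if_neg hc]
      rw [if_neg hne] at h
      simpa using h
  have hli : LinearIndependent ℂ (fun χ : Irr G => (χ : G → ℂ)) := by
    rw [linearIndependent_iff']
    intro s c hc ψ hψ
    have h1 : ∑ χ ∈ s, c χ * ((Nat.card G : ℂ)⁻¹ * ∑ g : G, χ g * ψ g⁻¹) = 0 := by
      have h2 : ∑ χ ∈ s, c χ * ((Nat.card G : ℂ)⁻¹ * ∑ g : G, χ g * ψ g⁻¹)
          = (Nat.card G : ℂ)⁻¹ * ∑ g : G, (∑ χ ∈ s, c χ * χ g) * ψ g⁻¹ := by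
        simp only [Finset.mul_sum, Finset.sum_mul]
        rw [Finset.sum_comm]
        refine Finset.sum_congr rfl fun _ _ => Finset.sum_congr rfl fun _ _ => ?_
        ring
      rw [h2]
      have h3 : ∀ g : G, ∑ χ ∈ s, c χ * χ g = 0 := by
        intro g
        have := congrFun hc g
        simpa using this
      simp [h3]
    simp only [key] at h1
    simpa [hψ] using h1
  exact hli.finite_of_isNoetherian

/-- A subset of `G` is `G`-invariant (normal) if it is closed under conjugation, that is, if it
is a union of conjugacy classes. -/
def IsInvariant {G : Type u} [Group G] (K : Set G) : Prop :=
  ∀ g : G, ∀ k ∈ K, g * k * g⁻¹ ∈ K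

/-- The function `σ_X = ∑_{χ ∈ X} χ(1) χ` on `G`, for a set `X` of irreducible characters. -/
def sigma {G : Type u} [Group G] (X : Set (Irr G)) : G → ℂ :=
  ∑ᶠ χ ∈ X, χ 1 • (χ : G → ℂ)

/-- The sum `K̂ = ∑_{g ∈ K} g` in the complex group algebra, for a subset `K` of `G`. -/
def blockSum {G : Type u} [Group G] (K : Set G) : MonoidAlgebra ℂ G :=
  ∑ᶠ g ∈ K, MonoidAlgebra.of ℂ G g

/-- The linear extension of the character `χ` to the group algebra. -/
def Irr.onAlgebra {G : Type u} [Group G] (χ : Irr G) (z : MonoidAlgebra ℂ G) : ℂ :=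
  z.coeff.sum fun g a => a * χ g

/-- `ω_χ(z) = χ(z) / χ(1)`. -/
def Irr.omega {G : Type u} [Group G] (χ : Irr G) (z : MonoidAlgebra ℂ G) : ℂ :=
  χ.onAlgebra z / χ 1

/-- The relation `g ∼ h` iff `σ_X(g) = σ_X(h)` for all `X ∈ 𝒳`. -/
def clRel {G : Type u} [Group G] (𝒳 : Set (Set (Irr G))) : Setoid G where
  r g h := ∀ X ∈ 𝒳, sigma X g = sigma X h
  iseqv := ⟨fun _ _ _ => rfl, fun h X hX => (h X hX).symm,
    fun h h' X hX => (h X hX).trans (h' X hX)⟩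

/-- The class partition of a collection `𝒳` of subsets of `Irr G`: the set of equivalence
classes of `clRel 𝒳`. -/
def ClPt {G : Type u} [Group G] (𝒳 : Set (Set (Irr G))) : Set (Set G) :=
  (clRel 𝒳).classes

/-- The relation `χ ∼ ψ` iff `χ(K̂) / χ(1) = ψ(K̂) / ψ(1)` for all `K ∈ 𝒦`. -/
def irRel {G : Type u} [Group G] (𝒦 : Set (Set G)) : Setoid (Irr G) where
  r χ ψ := ∀ K ∈ 𝒦, χ.omega (blockSum K) = ψ.omega (blockSum K)
  iseqv := ⟨fun _ _ _ => rfl, fun h K hK => (h K hK).symm,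
    fun h h' K hK => (h K hK).trans (h' K hK)⟩

/-- The partition of `Irr G` determined by a collection `𝒦` of subsets of `G`: the set of
equivalence classes of `irRel 𝒦`. -/
def IrPt {G : Type u} [Group G] (𝒦 : Set (Set G)) : Set (Set (Irr G)) :=
  (irRel 𝒦).classes

/-- The algebra `cf(G)` of class functions, with pointwise operations. -/
def cf (G : Type u) [Group G] : Subalgebra ℂ (G → ℂ) where
  carrier := {f | ∀ g h : G, f (g * h * g⁻¹) = f h}
  mul_mem' := by
    intro a b ha hb g h
    simp [ha g h, hb g h]
  add_mem' := by
    intro a b ha hb g h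
    simp [ha g h, hb g h]
  algebraMap_mem' := by
    intro r g h
    simp [Pi.algebraMap_apply]

/-- The characters `σ_X` are class functions. -/
theorem sigma_mem_cf {G : Type u} [Group G] (X : Set (Irr G)) : sigma X ∈ cf G := by
  unfold sigma
  refine finsum_mem_induction (fun f => f ∈ cf G) (zero_mem _) (fun _ _ => add_mem) ?_
  rintro ⟨_, V, i1, i2, i3, ρ, hρ, rfl⟩ -
  refine (cf G).smul_mem ?_ _
  intro g h
  exact Representation.char_conj ρ h g

/-- The sum over a `G`-invariant set is central in the group algebra. -/
theorem blockSum_mem_center {G : Type u} [Group G] [Finite G] {K : Set G} (hK : IsInvariant K) :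
    blockSum K ∈ Subalgebra.center ℂ (MonoidAlgebra ℂ G) := by
  have hconj : ∀ g : G, MonoidAlgebra.of ℂ G g * blockSum K
      = blockSum K * MonoidAlgebra.of ℂ G g := by
    intro g
    unfold blockSum
    rw [mul_finsum_mem' _ _ K.toFinite, finsum_mem_mul' _ _ K.toFinite]
    refine finsum_mem_eq_of_bijOn (fun k => g * k * g⁻¹) ⟨fun k hk => hK g k hk, ?_, ?_⟩ ?_
    · intro a _ b _ hab
      simpa using hab
    · intro k hk
      refine ⟨g⁻¹ * k * g, by simpa using hK g⁻¹ k hk, ?_⟩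
      simp [mul_assoc]
    · intro k _
      rw [← map_mul, ← map_mul]
      simp
  rw [Subalgebra.mem_center_iff]
  intro b
  induction b using MonoidAlgebra.induction_on with
  | of g => exact hconj g
  | add x y hx hy => rw [add_mul, mul_add, hx, hy]
  | smul r x hx => rw [smul_mul_assoc, mul_smul_comm, hx]

/-- The unital subalgebra of `Z(ℂG)` generated by the sums `K̂`, for `K` in a collection `𝒦` of
`G`-invariant subsets of `G`. -/
def blockSumAlgebra {G : Type u} [Group G] [Finite G] (𝒦 : Set (Set G))
    (h𝒦 : ∀ K ∈ 𝒦, IsInvariant K) :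
    Subalgebra ℂ (Subalgebra.center ℂ (MonoidAlgebra ℂ G)) :=
  Algebra.adjoin ℂ (Set.range fun K : 𝒦 => ⟨blockSum K.1, blockSum_mem_center (h𝒦 K.1 K.2)⟩)

/-- The unital subalgebra of `cf(G)` generated by the characters `σ_X`, for `X ∈ 𝒳`. -/
def sigmaAlgebra {G : Type u} [Group G] (𝒳 : Set (Set (Irr G))) : Subalgebra ℂ (cf G) :=
  Algebra.adjoin ℂ (Set.range fun X : 𝒳 => ⟨sigma X.1, sigma_mem_cf X.1⟩)

/-- `𝒞` is finer than `𝒟`: every block of `𝒞` is contained in a block of `𝒟`. -/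
def IsFiner {S : Type u} (𝒞 𝒟 : Set (Set S)) : Prop :=
  ∀ C ∈ 𝒞, ∃ D ∈ 𝒟, C ⊆ D

/-- `𝒞` is the coarsest partition of `S` with the property `P`: it is a partition with this
property, and every partition with this property is finer than `𝒞`. -/
def IsCoarsestPartition {S : Type u} (P : Set (Set S) → Prop) (𝒞 : Set (Set S)) : Prop :=
  Setoid.IsPartition 𝒞 ∧ P 𝒞 ∧ ∀ 𝒟, Setoid.IsPartition 𝒟 → P 𝒟 → IsFiner 𝒟 𝒞

end Supercharacter

end

open scoped ComplexConjugate ComplexOrder MonoidAlgebra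

/-! The central characters `ω_χ` together embed `Z(ℂG)` as an algebra into the functions on `Irr G`:
multiplicativity is Schur's lemma, injectivity is Maschke's theorem. A subalgebra of functions on a
finite set is determined by the points it fails to separate. So the algebra generated by the `K̂` is
the set of central elements whose `ω` is constant on the blocks of `IrPt 𝒦`, and the algebra
generated by the `σ_X` is the set of class functions constant on the blocks of `ClPt 𝒳`.

The linear map `f ↦ ∑ f(g⁻¹) g` takes class functions to central elements and, by orthogonality,
sends `σ_X` to the element whose `ω` is `|G|` on `X` and `0` elsewhere. Each generated algebra is
thus spanned by transforms of the sums on the other side, and lying in the span of a partition's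
sums means that coordinates are constant on its blocks. Reading off the coordinates of those
transforms gives exactly the relations defining the outer partition. The inversion does no harm,
since `σ_X(g⁻¹)` is the complex conjugate of `σ_X(g)`. -/

/-! ### Function algebras and partitions of finite sets -/

/-- A subalgebra of functions on a finite set contains every function that is constant on the
classes which the subalgebra does not separate. -/
theorem Subalgebra.mem_of_forall_eq_of_finite {k S : Type*} [Field k] [CharZero k] [Finite S]
    (B : Subalgebra k (S → k)) (f : S → k)
    (hf : ∀ a b, (∀ t ∈ B, t a = t b) → f a = f b) : f ∈ B := by
  classical
  have := Fintype.ofFinite S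
  have sep : ∀ a b, ∃ p ∈ B, p a = 1 ∧ ((∃ t ∈ B, t a ≠ t b) → p b = 0) := by
    intro a b
    by_cases h : ∃ t ∈ B, t a ≠ t b
    · obtain ⟨t, ht, hab⟩ := h
      refine ⟨(t a - t b)⁻¹ • (t - algebraMap k _ (t b)),
        B.smul_mem (B.sub_mem ht (B.algebraMap_mem _)) _, ?_, fun _ => ?_⟩
      · simp [inv_mul_cancel₀ (sub_ne_zero.mpr hab)]
      · simp
    · exact ⟨1, B.one_mem, rfl, fun h' => absurd h' h⟩
  choose p hpB hp1 hp0 using sep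
  -- `q a` is the indicator function of the class of `a`.
  set q : S → S → k := fun a => ∏ b, p a b with hq
  have hqB : ∀ a, q a ∈ B := fun a => B.prod_mem fun b _ => hpB a b
  have hq1 : ∀ a b, (∀ t ∈ B, t a = t b) → q a b = 1 := by
    intro a b h
    rw [← h _ (hqB a)]
    simp [hq, hp1]
  have hq0 : ∀ a b, ¬ (∀ t ∈ B, t a = t b) → q a b = 0 := by
    intro a b h
    push Not at h
    simp only [hq, Finset.prod_apply]
    exact Finset.prod_eq_zero (Finset.mem_univ b) (hp0 a b h)
  have hcard : ∀ b, (∑ a, q a b) ≠ 0 := by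
    intro b
    have : ∑ a, q a b = (Finset.univ.filter fun a => ∀ t ∈ B, t a = t b).card := by
      rw [Finset.card_filter, Nat.cast_sum]
      refine Finset.sum_congr rfl fun a _ => ?_
      split_ifs with h
      · simp [hq1 a b h]
      · simp [hq0 a b h]
    rw [this, Nat.cast_ne_zero]
    exact Finset.card_ne_zero_of_mem (Finset.mem_filter.mpr ⟨Finset.mem_univ b, fun _ _ => rfl⟩)
  -- Each class indicator occurs once per member of the class, hence the division by the class size.
  have hfe : f = ∑ a, (f a / ∑ c, q c a) • q a := by
    ext b
    simp only [Finset.sum_apply, Pi.smul_apply, smul_eq_mul]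
    have : ∀ a, f a / (∑ c, q c a) * q a b = f b / (∑ c, q c b) * q a b := by
      intro a
      by_cases h : ∀ t ∈ B, t a = t b
      · have h1 : (∑ c, q c a) = ∑ c, q c b :=
          Finset.sum_congr rfl fun c _ => h _ (hqB c)
        rw [hf a b h, h1]
      · simp [hq0 a b h]
    simp_rw [this]
    rw [← Finset.mul_sum, div_mul_cancel₀ _ (hcard b)]
  rw [hfe]
  exact B.sum_mem fun a _ => B.smul_mem (hqB a) _

/-- A linear combination with coefficients constant on the blocks of a partition is a linear
combination of the block sums. -/
theorem Setoid.IsPartition.sum_smul_mem_span {k S M : Type*} [Field k] [Fintype S]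
    [AddCommGroup M] [Module k M] {P : Set (Set S)} (hP : Setoid.IsPartition P)
    (v : S → M) (c : S → k) (hc : ∀ K ∈ P, ∀ s ∈ K, ∀ t ∈ K, c s = c t) :
    ∑ s, c s • v s ∈ Submodule.span k ((fun K : Set S => ∑ᶠ s ∈ K, v s) '' P) := by
  classical
  have := Fintype.ofFinite P
  choose b hb using fun s => (hP.2 s).exists
  let β : S → P := fun s => ⟨b s, (hb s).1⟩
  have hβ : ∀ (K : P) s, β s = K ↔ s ∈ K.1 := by
    intro K s
    refine ⟨fun h => h ▸ (hb s).2, fun h => Subtype.ext ?_⟩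
    exact (hP.2 s).unique (hb s) ⟨K.2, h⟩
  rw [← Finset.sum_fiberwise (s := Finset.univ) (g := β)]
  refine Submodule.sum_mem _ fun K _ => ?_
  obtain ⟨s₀, hs₀⟩ : K.1.Nonempty := Set.nonempty_iff_ne_empty.mpr fun h => hP.1 (h ▸ K.2)
  have : ∑ s with β s = K, c s • v s = c s₀ • ∑ᶠ s ∈ K.1, v s := by
    rw [finsum_mem_eq_sum_of_inter_support_eq (t := Finset.univ.filter fun s => β s = K),
      Finset.smul_sum]
    · refine Finset.sum_congr rfl fun s hs => ?_
      rw [hc K.1 K.2 s ((hβ K s).1 (Finset.mem_filter.1 hs).2) s₀ hs₀]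
    · congr 1
      ext s
      simp [hβ]
  rw [this]
  exact Submodule.smul_mem _ _ (Submodule.subset_span ⟨K.1, K.2, rfl⟩)

/-- Coordinates of a linear combination of block sums are constant on blocks. -/
theorem Setoid.IsPartition.coord_eq_of_mem_span {k S M : Type*} [Field k] [Finite S]
    [AddCommGroup M] [Module k M] {P : Set (Set S)} (hP : Setoid.IsPartition P)
    {v : S → M} (φ : S → M →ₗ[k] k) (h1 : ∀ s, φ s (v s) = 1)
    (h0 : ∀ s t, s ≠ t → φ s (v t) = 0) {z : M}
    (hz : z ∈ Submodule.span k ((fun K : Set S => ∑ᶠ s ∈ K, v s) '' P))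
    {K : Set S} (hK : K ∈ P) {s t : S} (hs : s ∈ K) (ht : t ∈ K) : φ s z = φ t z := by
  classical
  have := Fintype.ofFinite S
  have key : ∀ s (C : Set S), φ s (∑ᶠ t ∈ C, v t) = if s ∈ C then 1 else 0 := by
    intro s C
    rw [finsum_mem_eq_finite_toFinset_sum _ C.toFinite, map_sum]
    have : ∀ t, φ s (v t) = if s = t then 1 else 0 := by
      intro t
      split_ifs with h
      · rw [← h, h1]
      · exact h0 s t h
    simp [this]
  induction hz using Submodule.span_induction with
  | mem x hx =>
    obtain ⟨C, hC, rfl⟩ := hx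
    simp only [key]
    have : s ∈ C ↔ t ∈ C := by
      constructor
      · intro h
        rwa [(hP.2 s).unique ⟨hC, h⟩ ⟨hK, hs⟩]
      · intro h
        rwa [(hP.2 t).unique ⟨hC, h⟩ ⟨hK, ht⟩]
    simp [this]
  | zero => simp
  | add x y _ _ hx hy => simp [hx, hy]
  | smul a x _ hx => simp [hx]

/-! ### Characters at inverse elements -/

/-- The character of a complex representation of a finite group takes conjugate values on inverse
elements. -/
theorem Representation.character_inv_eq_conj {G V : Type*} [Group G] [Finite G] [AddCommGroup V]
    [Module ℂ V] [FiniteDimensional ℂ V] (ρ : Representation ℂ G V) (g : G) :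
    ρ.character g⁻¹ = conj (ρ.character g) := by
  classical
  have := Fintype.ofFinite G
  let b := Module.finBasis ℂ V
  let A : G → Matrix _ _ ℂ := fun g => LinearMap.toMatrix b b (ρ g)
  have hmul : ∀ g h, A (g * h) = A g * A h := fun g h => by
    simp only [A, map_mul, LinearMap.toMatrix_mul]
  have hone : A 1 = 1 := by simp only [A, map_one, LinearMap.toMatrix_one]
  -- Gram matrix of an invariant Hermitian form; the term at `1` makes it definite. Invariance then
  -- makes `A g⁻¹` similar to the conjugate transpose of `A g`.
  let Q : Matrix _ _ ℂ := ∑ h, (A h).conjTranspose * A h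
  have hQ : Q.PosDef := by
    have hs : Q = (A 1).conjTranspose * A 1 +
        ∑ h ∈ Finset.univ.erase 1, (A h).conjTranspose * A h :=
      (Finset.add_sum_erase _ _ (Finset.mem_univ (1 : G))).symm
    rw [hs]
    refine Matrix.PosDef.add_posSemidef ?_ ?_
    · simpa [hone] using Matrix.PosDef.one
    · exact Matrix.posSemidef_sum _ fun h _ => Matrix.posSemidef_conjTranspose_mul_self _
  have hinv : (A g).conjTranspose * Q * A g = Q := by
    simp only [Q, Finset.mul_sum, Finset.sum_mul]
    refine Fintype.sum_equiv (Equiv.mulRight g) _ _ fun h => ?_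
    simp only [Equiv.coe_mulRight, hmul, Matrix.conjTranspose_mul, mul_assoc]
  have hdet : IsUnit Q.det := (Matrix.isUnit_iff_isUnit_det _).1 hQ.isUnit
  have hAA : A g * A g⁻¹ = 1 := by rw [← hmul, mul_inv_cancel, hone]
  have h2 : (A g).conjTranspose * Q = Q * A g⁻¹ := by
    calc (A g).conjTranspose * Q = (A g).conjTranspose * Q * (A g * A g⁻¹) := by rw [hAA, mul_one]
      _ = Q * A g⁻¹ := by rw [← mul_assoc, hinv]
  have h3 : A g⁻¹ = Q⁻¹ * ((A g).conjTranspose * Q) := by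
    rw [h2, ← mul_assoc, Matrix.nonsing_inv_mul _ hdet, one_mul]
  have h4 : ∀ x, ρ.character x = (A x).trace := fun x =>
    LinearMap.trace_eq_matrix_trace ℂ b (ρ x)
  rw [h4, h4, h3, Matrix.trace_mul_comm, mul_assoc, Matrix.mul_nonsing_inv _ hdet, mul_one,
    Matrix.trace_conjTranspose]
  rfl

theorem Setoid.rel_of_mem_classes {S : Type*} {r : Setoid S} {C : Set S} (hC : C ∈ r.classes)
    {a b : S} (ha : a ∈ C) (hb : b ∈ C) : r a b := by
  obtain ⟨c, rfl⟩ := hC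
  exact r.trans' ha (r.symm' hb)

/-! ### Central characters -/

namespace Supercharacter

universe u

variable {G : Type u} [Group G]

theorem Irr.one_ne_zero (χ : Irr G) : χ 1 ≠ 0 := by
  obtain ⟨V, _, _, _, ρ, hρ, h⟩ := χ.2
  have : Nontrivial V := by
    have := IsSimpleModule.nontrivial ℂ[G] ρ.asModule
    exact this
  rw [← h, Representation.char_one, Nat.cast_ne_zero]
  exact Module.finrank_pos.ne'

theorem Irr.conj_mem (χ : Irr G) (g h : G) : χ (g * h * g⁻¹) = χ h := by
  obtain ⟨V, _, _, _, ρ, hρ, e⟩ := χ.2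
  rw [← e, Representation.char_conj]

/-- A central element of the group algebra acts on an irreducible representation affording `χ` as
the scalar `ω_χ`. -/
theorem Irr.asAlgebraHom_eq_omega_smul (χ : Irr G) {V : Type u} [AddCommGroup V] [Module ℂ V]
    [FiniteDimensional ℂ V] (ρ : Representation ℂ G V) (hρ : ρ.IsIrreducible)
    (h : ρ.character = χ) {z : ℂ[G]} (hz : z ∈ Subalgebra.center ℂ ℂ[G]) :
    ρ.asAlgebraHom z = χ.omega z • (1 : Module.End ℂ V) := by
  have hcomm : ∀ g v, ρ.asAlgebraHom z (ρ g v) = ρ g (ρ.asAlgebraHom z v) := by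
    intro g v
    have := congrArg ρ.asAlgebraHom
      (Subalgebra.mem_center_iff.1 hz (MonoidAlgebra.of ℂ G g))
    rw [map_mul, map_mul, Representation.asAlgebraHom_of] at this
    exact (LinearMap.congr_fun this v).symm
  let f := LinearMap.intertwiningMap_of_isIntertwiningMap ρ ρ (ρ.asAlgebraHom z) hcomm
  -- Schur's lemma; taking traces below identifies the scalar.
  obtain ⟨c, hc⟩ :=
    (Representation.IsIrreducible.algebraMap_intertwiningMap_bijective_of_isAlgClosed (ρ := ρ)).2 f
  have hc' : ρ.asAlgebraHom z = c • (1 : Module.End ℂ V) :=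
    (congrArg Representation.IntertwiningMap.toLinearMap hc).symm
  have htr : LinearMap.trace ℂ V (ρ.asAlgebraHom z) = χ.onAlgebra z := by
    rw [Representation.asAlgebraHom_def, MonoidAlgebra.lift_apply, Finsupp.sum, map_sum]
    unfold Irr.onAlgebra
    rw [Finsupp.sum]
    refine Finset.sum_congr rfl fun g _ => ?_
    rw [map_smul, smul_eq_mul, ← h]
    rfl
  have hcω : c = χ.omega z := by
    rw [Irr.omega, ← htr, hc', map_smul, LinearMap.trace_one, eq_div_iff χ.one_ne_zero, ← h,
      Representation.char_one, smul_eq_mul]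
  rw [hc', hcω]

/-- `ω_χ` as a linear functional on the group algebra. -/
noncomputable def Irr.omegaLin (χ : Irr G) : ℂ[G] →ₗ[ℂ] ℂ where
  toFun := χ.omega
  map_add' x y := by
    simp only [Irr.omega, Irr.onAlgebra, MonoidAlgebra.coeff_add]
    rw [Finsupp.sum_add_index' (by simp) (by intros; ring), add_div]
  map_smul' a x := by
    simp only [Irr.omega, Irr.onAlgebra, MonoidAlgebra.coeff_smul]
    rw [Finsupp.sum_smul_index' (by simp)]
    simp only [Finsupp.sum, smul_eq_mul, mul_assoc, ← Finset.mul_sum, RingHom.id_apply,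
      mul_div_assoc]

theorem Irr.omega_of (χ : Irr G) (g : G) : χ.omega (MonoidAlgebra.of ℂ G g) = χ g / χ 1 := by
  simp [Irr.omega, Irr.onAlgebra]

/-- The central characters, as an algebra homomorphism from the centre of the group algebra to
the functions on the irreducible characters. -/
noncomputable def omegaHom (G : Type u) [Group G] : Subalgebra.center ℂ ℂ[G] →ₐ[ℂ] (Irr G → ℂ) :=
  AlgHom.ofLinearMap
    (LinearMap.pi fun χ => χ.omegaLin ∘ₗ (Subalgebra.center ℂ ℂ[G]).val.toLinearMap)
    (by
      ext χ
      change χ.omega (MonoidAlgebra.of ℂ G 1) = 1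
      rw [Irr.omega_of, div_self χ.one_ne_zero])
    (by
      intro x y
      ext χ
      change χ.omega (x.1 * y.1) = χ.omega x.1 * χ.omega y.1
      obtain ⟨V, _, _, _, ρ, hρ, h⟩ := χ.2
      have : Nontrivial V := by
        have := IsSimpleModule.nontrivial ℂ[G] ρ.asModule
        exact this
      have h1 := χ.asAlgebraHom_eq_omega_smul ρ hρ h (mul_mem x.2 y.2)
      rw [map_mul, χ.asAlgebraHom_eq_omega_smul ρ hρ h x.2,
        χ.asAlgebraHom_eq_omega_smul ρ hρ h y.2, smul_mul_smul_comm, mul_one] at h1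
      exact (smul_left_injective ℂ (one_ne_zero : (1 : Module.End ℂ V) ≠ 0) h1).symm)

theorem mem_cf_of_mem_center {z : ℂ[G]} (hz : z ∈ Subalgebra.center ℂ ℂ[G]) :
    (fun g => z.coeff g⁻¹) ∈ cf G := by
  intro g h
  -- At `g * h⁻¹`, the products `g z` and `z g` have coefficients `z(h⁻¹)` and `z(g h⁻¹ g⁻¹)`.
  have := congrArg (fun z : ℂ[G] => z.coeff (g * h⁻¹))
    (Subalgebra.mem_center_iff.1 hz (MonoidAlgebra.of ℂ G g))
  simp only [MonoidAlgebra.of_apply, MonoidAlgebra.coeff_single_mul_apply,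
      MonoidAlgebra.coeff_mul_single_apply, one_mul, mul_one, inv_mul_cancel_left] at this
  simp only [mul_inv_rev, inv_inv]
  rw [this, mul_assoc]

variable [Finite G]

/-- A central element at which all central characters vanish annihilates every simple module. -/
theorem smul_eq_zero_of_omega_eq_zero {z : ℂ[G]} (hz : z ∈ Subalgebra.center ℂ ℂ[G])
    (h : ∀ χ : Irr G, χ.omega z = 0) {M : Type u} [AddCommGroup M] [Module ℂ M] [Module ℂ[G] M]
    [IsScalarTower ℂ ℂ[G] M] [IsSimpleModule ℂ[G] M] (m : M) : z • m = 0 := by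
  have : Module.Finite ℂ ℂ[G] := Module.Finite.of_basis (MonoidAlgebra.basis G ℂ)
  have : FiniteDimensional ℂ M := Module.Finite.trans ℂ[G] M
  let ρ : Representation ℂ G M := Representation.ofModule' M
  have hsmul : ∀ (y : ℂ[G]) (m : M), ρ.asAlgebraHom y m = y • m := fun y m =>
    LinearMap.congr_fun (AlgHom.congr_fun
      ((MonoidAlgebra.lift ℂ (Module.End ℂ M) G).apply_symm_apply (Algebra.lsmul ℂ ℂ M)) y) m
  let e : ρ.asModule ≃ₗ[ℂ[G]] M :=
    { ρ.asModuleEquiv with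
      map_smul' := fun y m => (ρ.asModuleEquiv_map_smul y m).trans (hsmul y _) }
  have hρ : ρ.IsIrreducible :=
    (Representation.irreducible_iff_isSimpleModule_asModule ρ).2 (IsSimpleModule.congr e)
  let χ : Irr G := ⟨ρ.character, M, _, _, this, ρ, hρ, rfl⟩
  rw [← hsmul, χ.asAlgebraHom_eq_omega_smul ρ hρ rfl hz, h χ, zero_smul]
  rfl

/-- The central characters separate the elements of the centre of the group algebra. -/
theorem eq_zero_of_omega_eq_zero {z : ℂ[G]} (hz : z ∈ Subalgebra.center ℂ ℂ[G])
    (h : ∀ χ : Irr G, χ.omega z = 0) : z = 0 := by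
  have : NeZero (Nat.card G : ℂ) := ⟨by exact_mod_cast Nat.card_pos.ne'⟩
  -- By Maschke, `ℂ[G]` is the sum of its simple submodules, all killed by `z`.
  have hmem : z ∈ Module.annihilator ℂ[G] ℂ[G] := by
    rw [← Submodule.annihilator_top, ← IsSemisimpleModule.sSup_simples_eq_top, sSup_eq_iSup',
      Submodule.annihilator_iSup, Submodule.mem_iInf]
    rintro ⟨N, hN⟩
    have hN : IsSimpleModule ℂ[G] N := hN
    exact Module.mem_annihilator.2 fun n => smul_eq_zero_of_omega_eq_zero hz h n
  simpa using Module.mem_annihilator.1 hmem 1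

/-! ### The transform from class functions to the centre -/

/-- The linear map sending a function `f` to `∑ f(g⁻¹) g`. -/
noncomputable def toAlgebra (G : Type u) [Group G] [Finite G] : (G → ℂ) →ₗ[ℂ] ℂ[G] where
  toFun f := MonoidAlgebra.ofCoeff (Finsupp.equivFunOnFinite.symm fun g => f g⁻¹)
  map_add' _ _ := by ext; simp
  map_smul' _ _ := by ext; simp

@[simp]
theorem coeff_toAlgebra (f : G → ℂ) (g : G) : (toAlgebra G f).coeff g = f g⁻¹ := rfl

theorem toAlgebra_injective : Function.Injective (toAlgebra G) := by
  intro f f' h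
  ext g
  simpa using congrArg (fun z : ℂ[G] => z.coeff g⁻¹) h

theorem toAlgebra_eq {z : ℂ[G]} : toAlgebra G (fun g => z.coeff g⁻¹) = z := by
  ext g
  simp

theorem toAlgebra_mem_center {f : G → ℂ} (hf : f ∈ cf G) :
    toAlgebra G f ∈ Subalgebra.center ℂ ℂ[G] := by
  rw [Subalgebra.mem_center_iff]
  intro b
  induction b using MonoidAlgebra.induction_on with
  | of g =>
    ext h
    have := hf g (h⁻¹ * g)
    simp only [MonoidAlgebra.of_apply, MonoidAlgebra.coeff_single_mul_apply,
      MonoidAlgebra.coeff_mul_single_apply, coeff_toAlgebra, one_mul, mul_one]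
    rw [mul_inv_rev, mul_inv_rev, inv_inv, ← this]
    congr 1
    group
  | add x y hx hy => rw [add_mul, mul_add, hx, hy]
  | smul r x hx => rw [smul_mul_assoc, mul_smul_comm, hx]

-- Row orthogonality: `χ(1) χ` is sent to `|G|` times the central idempotent of `χ`.
open scoped Classical in
theorem Irr.omega_toAlgebra (χ ψ : Irr G) :
    ψ.omega (toAlgebra G (χ 1 • (χ : G → ℂ))) = if χ = ψ then (Nat.card G : ℂ) else 0 := by
  have := Fintype.ofFinite G
  have hcard : (Nat.card G : ℂ) ≠ 0 := by exact_mod_cast Nat.card_pos.ne'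
  have : Invertible (Nat.card G : ℂ) := invertibleOfNonzero hcard
  have key : (Nat.card G : ℂ)⁻¹ * ∑ g : G, ψ g * χ g⁻¹ = if χ = ψ then 1 else 0 := by
    obtain ⟨V, i1, i2, i3, ρ, hρ, hρψ⟩ := ψ.2
    obtain ⟨W, j1, j2, j3, σ, hσ, hσχ⟩ := χ.2
    rw [← hρψ, ← hσχ, Representation.char_orthonormal]
    by_cases hc : χ = ψ
    · subst hc
      -- The inner product depends only on the characters, so its value is carried over from the
      -- pair `ρ, ρ` without first knowing that `ρ` and `σ` are isomorphic.
      have h' := Representation.char_orthonormal ρ ρ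
      rw [if_pos ⟨Representation.Equiv.refl ρ⟩, hρψ, ← hσχ] at h'
      have h := Representation.char_orthonormal ρ σ
      rw [hρψ, ← hσχ, h'] at h
      rw [← h, if_pos rfl]
    · rw [if_neg hc, if_neg]
      rintro ⟨φ⟩
      exact hc (Subtype.ext (hσχ.symm.trans ((Representation.char_iso φ).trans hρψ)))
  have hon : ψ.omega (toAlgebra G (χ 1 • (χ : G → ℂ)))
      = χ 1 / ψ 1 * ∑ g : G, ψ g * χ g⁻¹ := by
    rw [Irr.omega, Irr.onAlgebra, Finsupp.sum_fintype _ _ (by simp), Finset.mul_sum,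
      Finset.sum_div]
    refine Finset.sum_congr rfl fun g _ => ?_
    simp only [coeff_toAlgebra, Pi.smul_apply, smul_eq_mul]
    ring
  rw [inv_mul_eq_iff_eq_mul₀ hcard] at key
  rw [hon, key]
  split_ifs with h
  · rw [h, div_self ψ.one_ne_zero, one_mul, mul_one]
  · simp

/-- The expansion of a class function in irreducible characters. -/
theorem sum_omega_toAlgebra_smul [Fintype (Irr G)] {f : G → ℂ} (hf : f ∈ cf G) :
    ∑ χ : Irr G, ((Nat.card G : ℂ)⁻¹ * χ.omega (toAlgebra G f)) • χ 1 • (χ : G → ℂ) = f := by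
  classical
  have hcard : (Nat.card G : ℂ) ≠ 0 := by exact_mod_cast Nat.card_pos.ne'
  have hmem : ∑ χ : Irr G, ((Nat.card G : ℂ)⁻¹ * χ.omega (toAlgebra G f)) • χ 1 • (χ : G → ℂ)
      ∈ cf G :=
    sum_mem fun χ _ => (cf G).smul_mem ((cf G).smul_mem χ.conj_mem _) _
  apply toAlgebra_injective
  rw [← sub_eq_zero, ← map_sub]
  refine eq_zero_of_omega_eq_zero (toAlgebra_mem_center (sub_mem hmem hf)) fun ψ => ?_
  change ψ.omegaLin _ = 0
  rw [map_sub, map_sub, map_sum, map_sum, sub_eq_zero]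
  have : ∀ χ : Irr G, ψ.omegaLin (toAlgebra G (χ 1 • (χ : G → ℂ)))
      = if χ = ψ then (Nat.card G : ℂ) else 0 := fun χ => χ.omega_toAlgebra ψ
  simp only [map_smul _ ((Nat.card G : ℂ)⁻¹ * _), this]
  simp only [smul_eq_mul, mul_ite, mul_zero, Finset.sum_ite_eq', Finset.mem_univ, if_true]
  rw [mul_right_comm, inv_mul_cancel₀ hcard, one_mul]
  rfl

theorem sigma_inv (X : Set (Irr G)) (g : G) : sigma X g⁻¹ = conj (sigma X g) := by
  have hχ : ∀ (χ : Irr G) g, χ g⁻¹ = conj (χ g) := by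
    intro χ g
    obtain ⟨V, _, _, _, ρ, hρ, h⟩ := χ.2
    rw [← h, ρ.character_inv_eq_conj]
  have h1 : ∀ χ : Irr G, conj (χ 1) = χ 1 := fun χ => by rw [← hχ, inv_one]
  unfold sigma
  rw [finsum_mem_eq_finite_toFinset_sum _ X.toFinite]
  simp [hχ, h1]

/-- Absorbs the inversion built into `toAlgebra`. -/
theorem clRel_inv {𝒳 : Set (Set (Irr G))} {g h : G} (H : clRel 𝒳 g h) : clRel 𝒳 g⁻¹ h⁻¹ := by
  intro X hX
  rw [sigma_inv, sigma_inv, H X hX]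

/-! ### Spans of block sums, in coordinates -/

theorem mem_span_blockSum {P : Set (Set G)} (hP : Setoid.IsPartition P) {z : ℂ[G]}
    (hz : ∀ K ∈ P, ∀ g ∈ K, ∀ h ∈ K, z.coeff g = z.coeff h) :
    z ∈ Submodule.span ℂ (blockSum '' P) := by
  have := Fintype.ofFinite G
  have h := hP.sum_smul_mem_span (fun g => MonoidAlgebra.of ℂ G g) z.coeff hz
  have he : ∑ g, z.coeff g • MonoidAlgebra.of ℂ G g = z := by
    rw [← Finsupp.sum_fintype z.coeff (fun g a => a • MonoidAlgebra.of ℂ G g) (by simp)]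
    simp
  rw [he] at h
  exact h

theorem coeff_eq_of_mem_span_blockSum {P : Set (Set G)} (hP : Setoid.IsPartition P) {z : ℂ[G]}
    (hz : z ∈ Submodule.span ℂ (blockSum '' P)) {K : Set G} (hK : K ∈ P) {g h : G}
    (hg : g ∈ K) (hh : h ∈ K) : z.coeff g = z.coeff h := by
  classical
  exact hP.coord_eq_of_mem_span (v := fun g => MonoidAlgebra.of ℂ G g)
    (fun s => { toFun := fun z : ℂ[G] => z.coeff s
                map_add' := fun _ _ => rfl
                map_smul' := fun _ _ => rfl })
    (fun s => Finsupp.single_eq_same)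
    (fun s t hst => Finsupp.single_eq_of_ne hst) hz hK hg hh

theorem mem_span_sigma {P : Set (Set (Irr G))} (hP : Setoid.IsPartition P) {f : G → ℂ}
    (hf : f ∈ cf G)
    (h : ∀ Y ∈ P, ∀ χ ∈ Y, ∀ ψ ∈ Y, χ.omega (toAlgebra G f) = ψ.omega (toAlgebra G f)) :
    f ∈ Submodule.span ℂ (sigma '' P) := by
  have := Fintype.ofFinite (Irr G)
  rw [← sum_omega_toAlgebra_smul hf]
  refine hP.sum_smul_mem_span (fun χ : Irr G => χ 1 • (χ : G → ℂ)) _ fun Y hY χ hχ ψ hψ => ?_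
  rw [h Y hY χ hχ ψ hψ]

theorem omega_eq_of_mem_span_sigma {P : Set (Set (Irr G))} (hP : Setoid.IsPartition P)
    {f : G → ℂ} (hf : f ∈ Submodule.span ℂ (sigma '' P)) {Y : Set (Irr G)} (hY : Y ∈ P)
    {χ ψ : Irr G} (hχ : χ ∈ Y) (hψ : ψ ∈ Y) :
    χ.omega (toAlgebra G f) = ψ.omega (toAlgebra G f) := by
  classical
  have hcard : (Nat.card G : ℂ) ≠ 0 := by exact_mod_cast Nat.card_pos.ne'
  have h := hP.coord_eq_of_mem_span (v := fun χ : Irr G => χ 1 • (χ : G → ℂ))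
    -- The functionals dual to the family `χ(1) χ`.
    (fun χ => (Nat.card G : ℂ)⁻¹ • (χ.omegaLin ∘ₗ toAlgebra G))
    (fun χ => by
      change _ * χ.omega (toAlgebra G _) = 1
      rw [Irr.omega_toAlgebra, if_pos rfl, inv_mul_cancel₀ hcard])
    (fun χ ψ hne => by
      change _ * χ.omega (toAlgebra G _) = 0
      rw [Irr.omega_toAlgebra, if_neg hne.symm, mul_zero])
    hf hY hχ hψ
  exact mul_left_cancel₀ (inv_ne_zero hcard) h

end Supercharacter

/-! ### The generated algebras and the coarsest partitions -/

namespace Supercharacter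

universe u

variable {G : Type u} [Group G]

theorem ClPt_isPartition (𝒳 : Set (Set (Irr G))) : Setoid.IsPartition (ClPt 𝒳) :=
  Setoid.isPartition_classes _

theorem IrPt_isPartition (𝒦 : Set (Set G)) : Setoid.IsPartition (IrPt 𝒦) :=
  Setoid.isPartition_classes _

/-- A partition is finer than the classes of an equivalence relation if any two elements of a
block are related. -/
theorem isFiner_classes {S : Type u} {r : Setoid S} {𝒟 : Set (Set S)}
    (h𝒟 : Setoid.IsPartition 𝒟) (h : ∀ D ∈ 𝒟, ∀ a ∈ D, ∀ b ∈ D, r a b) :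
    IsFiner 𝒟 r.classes := by
  intro D hD
  obtain ⟨a, ha⟩ : D.Nonempty := Set.nonempty_iff_ne_empty.mpr fun h => h𝒟.1 (h ▸ hD)
  exact ⟨_, r.mem_classes a, fun b hb => h D hD b hb a ha⟩

theorem isInvariant_of_mem_ClPt {𝒳 : Set (Set (Irr G))} {K : Set G} (hK : K ∈ ClPt 𝒳) :
    IsInvariant K := by
  obtain ⟨c, rfl⟩ := hK
  intro g k hk X hX
  rw [sigma_mem_cf X g k]
  exact hk X hX

variable [Finite G]

/-- A central element lies in the algebra generated by the block sums if and only if its central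
character values are constant on the blocks of `IrPt 𝒦`. -/
theorem mem_blockSumAlgebra_iff {𝒦 : Set (Set G)} (h𝒦 : ∀ K ∈ 𝒦, IsInvariant K)
    (z : Subalgebra.center ℂ ℂ[G]) :
    z ∈ blockSumAlgebra 𝒦 h𝒦 ↔ ∀ χ ψ : Irr G, irRel 𝒦 χ ψ → χ.omega z.1 = ψ.omega z.1 := by
  constructor
  · intro hz χ ψ h
    let ev (χ : Irr G) : Subalgebra.center ℂ ℂ[G] →ₐ[ℂ] ℂ :=
      (Pi.evalAlgHom ℂ (fun _ : Irr G => ℂ) χ).comp (omegaHom G)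
    -- Two algebra homomorphisms agree on a subalgebra once they agree on generators.
    have hle : blockSumAlgebra 𝒦 h𝒦 ≤ AlgHom.equalizer (ev χ) (ev ψ) := by
      refine Algebra.adjoin_le ?_
      rintro _ ⟨K, rfl⟩
      exact h K.1 K.2
    exact hle hz
  · intro h
    have hmem : omegaHom G z ∈ (blockSumAlgebra 𝒦 h𝒦).map (omegaHom G) := by
      refine Subalgebra.mem_of_forall_eq_of_finite _ _ fun χ ψ hχψ => h χ ψ fun K hK => ?_
      exact hχψ _ ⟨_, Algebra.subset_adjoin ⟨⟨K, hK⟩, rfl⟩, rfl⟩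
    obtain ⟨w, hw, hwz⟩ := hmem
    have : w.1 - z.1 = 0 := by
      refine eq_zero_of_omega_eq_zero (sub_mem w.2 z.2) fun χ => ?_
      change omegaHom G (w - z) χ = 0
      rw [map_sub]
      exact congrFun (sub_eq_zero.2 hwz) χ
    rwa [← Subtype.ext (sub_eq_zero.1 this)]

/-- The algebra generated by the characters `σ_X` consists of the class functions constant on the blocks
of `ClPt 𝒳`. -/
theorem mem_sigmaAlgebra_iff {𝒳 : Set (Set (Irr G))} (f : cf G) :
    f ∈ sigmaAlgebra 𝒳 ↔ ∀ g h : G, clRel 𝒳 g h → f.1 g = f.1 h := by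
  constructor
  · intro hf g h H
    let ev (g : G) : cf G →ₐ[ℂ] ℂ := (Pi.evalAlgHom ℂ (fun _ : G => ℂ) g).comp (cf G).val
    have hle : sigmaAlgebra 𝒳 ≤ AlgHom.equalizer (ev g) (ev h) := by
      refine Algebra.adjoin_le ?_
      rintro _ ⟨X, rfl⟩
      exact H X.1 X.2
    exact hle hf
  · intro h
    have hmem : f.1 ∈ (sigmaAlgebra 𝒳).map (cf G).val := by
      refine Subalgebra.mem_of_forall_eq_of_finite _ _ fun a b hab => h a b fun X hX => ?_
      exact hab _ ⟨_, Algebra.subset_adjoin ⟨⟨X, hX⟩, rfl⟩, rfl⟩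
    obtain ⟨w, hw, hwf⟩ := hmem
    rwa [← Subtype.ext hwf]

theorem mem_span_blockSum_of_mem_blockSumAlgebra {𝒦 : Set (Set G)}
    (h𝒦 : ∀ K ∈ 𝒦, IsInvariant K) {z : Subalgebra.center ℂ ℂ[G]}
    (hz : z ∈ blockSumAlgebra 𝒦 h𝒦) :
    z.1 ∈ Submodule.span ℂ (blockSum '' ClPt (IrPt 𝒦)) := by
  have hspan : (fun g => z.1.coeff g⁻¹) ∈ Submodule.span ℂ (sigma '' IrPt 𝒦) := by
    refine mem_span_sigma (IrPt_isPartition 𝒦) (mem_cf_of_mem_center z.2)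
      fun Y hY χ hχ ψ hψ => ?_
    rw [toAlgebra_eq]
    exact (mem_blockSumAlgebra_iff h𝒦 z).1 hz χ ψ (Setoid.rel_of_mem_classes hY hχ hψ)
  have hconst : ∀ g h : G, clRel (IrPt 𝒦) g h → z.1.coeff g⁻¹ = z.1.coeff h⁻¹ := by
    intro g h H
    let d : (G → ℂ) →ₗ[ℂ] ℂ := LinearMap.proj (R := ℂ) (φ := fun _ : G => ℂ) g -
      LinearMap.proj (R := ℂ) (φ := fun _ : G => ℂ) h
    have hle : Submodule.span ℂ (sigma '' IrPt 𝒦) ≤ LinearMap.ker d := by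
      refine Submodule.span_le.2 ?_
      rintro _ ⟨X, hX, rfl⟩
      exact sub_eq_zero.2 (H X hX)
    exact sub_eq_zero.1 (hle hspan)
  refine mem_span_blockSum (ClPt_isPartition _) fun K hK g hg h hh => ?_
  simpa using hconst _ _ (clRel_inv (Setoid.rel_of_mem_classes hK hg hh))

/-- The test elements are the transforms of `σ_X` for `X ∈ IrPt 𝒦`: they lie in the algebra, so
their coefficients `σ_X(g⁻¹)` are constant on the blocks of `𝒟`. -/
theorem isFiner_ClPt_IrPt {𝒦 : Set (Set G)} (h𝒦 : ∀ K ∈ 𝒦, IsInvariant K) {𝒟 : Set (Set G)}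
    (h𝒟 : Setoid.IsPartition 𝒟)
    (h : ∀ z ∈ blockSumAlgebra 𝒦 h𝒦, (z : ℂ[G]) ∈ Submodule.span ℂ (blockSum '' 𝒟)) :
    IsFiner 𝒟 (ClPt (IrPt 𝒦)) := by
  refine isFiner_classes h𝒟 fun D hD a ha b hb X hX => ?_
  have hmem : (⟨toAlgebra G (sigma X), toAlgebra_mem_center (sigma_mem_cf X)⟩ :
      Subalgebra.center ℂ ℂ[G]) ∈ blockSumAlgebra 𝒦 h𝒦 := by
    rw [mem_blockSumAlgebra_iff]
    intro χ ψ hχψ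
    exact omega_eq_of_mem_span_sigma (IrPt_isPartition 𝒦)
      (Submodule.subset_span ⟨X, hX, rfl⟩) ((irRel 𝒦).mem_classes ψ) hχψ ((irRel 𝒦).refl' ψ)
  have := coeff_eq_of_mem_span_blockSum h𝒟 (h _ hmem) hD ha hb
  simp only [coeff_toAlgebra, sigma_inv] at this
  exact (starRingEnd ℂ).injective this

theorem mem_span_sigma_of_mem_sigmaAlgebra {𝒳 : Set (Set (Irr G))} {f : cf G}
    (hf : f ∈ sigmaAlgebra 𝒳) :
    f.1 ∈ Submodule.span ℂ (sigma '' IrPt (ClPt 𝒳)) := by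
  have hspan : toAlgebra G f.1 ∈ Submodule.span ℂ (blockSum '' ClPt 𝒳) :=
    mem_span_blockSum (ClPt_isPartition 𝒳) fun K hK g hg h hh =>
      (mem_sigmaAlgebra_iff f).1 hf _ _ (clRel_inv (Setoid.rel_of_mem_classes hK hg hh))
  refine mem_span_sigma (IrPt_isPartition _) f.2 fun Y hY χ hχ ψ hψ => ?_
  have hle : Submodule.span ℂ (blockSum '' ClPt 𝒳) ≤ LinearMap.ker (χ.omegaLin - ψ.omegaLin) := by
    refine Submodule.span_le.2 ?_
    rintro _ ⟨K, hK, rfl⟩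
    exact sub_eq_zero.2 (Setoid.rel_of_mem_classes hY hχ hψ K hK)
  exact sub_eq_zero.1 (hle hspan)

/-- Dually, the test functions are `g ↦ K̂(g⁻¹)` for `K ∈ ClPt 𝒳`, whose transform is `K̂` itself.
-/
theorem isFiner_IrPt_ClPt {𝒳 : Set (Set (Irr G))} {𝒟 : Set (Set (Irr G))}
    (h𝒟 : Setoid.IsPartition 𝒟)
    (h : ∀ f ∈ sigmaAlgebra 𝒳, (f : G → ℂ) ∈ Submodule.span ℂ (sigma '' 𝒟)) :
    IsFiner 𝒟 (IrPt (ClPt 𝒳)) := by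
  refine isFiner_classes h𝒟 fun D hD χ hχ ψ hψ K hK => ?_
  have hf : (fun g => (blockSum K).coeff g⁻¹) ∈ cf G :=
    mem_cf_of_mem_center (blockSum_mem_center (isInvariant_of_mem_ClPt hK))
  have hmem : (⟨_, hf⟩ : cf G) ∈ sigmaAlgebra 𝒳 := by
    rw [mem_sigmaAlgebra_iff]
    intro g k hgk
    exact coeff_eq_of_mem_span_blockSum (ClPt_isPartition 𝒳)
      (Submodule.subset_span ⟨K, hK, rfl⟩) ((clRel 𝒳).mem_classes k⁻¹) (clRel_inv hgk)
      ((clRel 𝒳).refl' _)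
  have := omega_eq_of_mem_span_sigma h𝒟 (h _ hmem) hD hχ hψ
  rwa [toAlgebra_eq] at this

end Supercharacter

theorem mainTheorem5 {G : Type*} [Group G] [Finite G] :
    (∀ (𝒦 : Set (Set G)) (h𝒦 : ∀ K ∈ 𝒦, Supercharacter.IsInvariant K),
      Supercharacter.IsCoarsestPartition
        (fun ℒ : Set (Set G) =>
          ∀ z ∈ Supercharacter.blockSumAlgebra 𝒦 h𝒦,
            (z : MonoidAlgebra ℂ G) ∈ Submodule.span ℂ (Supercharacter.blockSum '' ℒ))
        (Supercharacter.ClPt (Supercharacter.IrPt 𝒦))) ∧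
    (∀ 𝒳 : Set (Set (Supercharacter.Irr G)),
      Supercharacter.IsCoarsestPartition
        (fun 𝒴 : Set (Set (Supercharacter.Irr G)) =>
          ∀ f ∈ Supercharacter.sigmaAlgebra 𝒳,
            (f : G → ℂ) ∈ Submodule.span ℂ (Supercharacter.sigma '' 𝒴))
        (Supercharacter.IrPt (Supercharacter.ClPt 𝒳))) :=
  ⟨fun _ h𝒦 => ⟨Supercharacter.ClPt_isPartition _,
      fun _ hz => Supercharacter.mem_span_blockSum_of_mem_blockSumAlgebra h𝒦 hz,
      fun _ h𝒟 h => Supercharacter.isFiner_ClPt_IrPt h𝒦 h𝒟 h⟩,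
    fun _ => ⟨Supercharacter.IrPt_isPartition _,
      fun _ hf => Supercharacter.mem_span_sigma_of_mem_sigmaAlgebra hf,
      fun _ h𝒟 h => Supercharacter.isFiner_IrPt_ClPt h𝒟 h⟩⟩
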